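/- Let $q\ge 2$ be an integer. A \emph{stranded graph} $G$ consists of a finite set of vertices, each carrying exactly $q$ fermionic half-edges; a perfect matching of all the half-edges into \emph{fermionic lines}; a perfect matching of the vertices into \emph{disorder edges}; and, for each disorder edge $\{v,w\}$, a bijection between the half-edges at $v$ and those at $w$, whose $q$ matched pairs are the \emph{strands} of the disorder edge. A \emph{Feynman graph of the SYK model} is a stranded graph whose $q$-regular multigraph $G_0$ of fermionic lines (disorder edges removed) is connected and loopless. A \emph{face} of $G$ is a cycle alternating between fermionic lines and strands. Let $F(G)$ and $V(G)$ be the numbers of faces and of vertices, and let the SYK degree be $$\delta(G)=F(G)-(q-1)\frac{V(G)}{2}.$$ Let $G_{\min}$ be the graph with two vertices joined by $q$ fermionic lines and by a disorder edge each of whose strands joins the two ends of one fermionic line. The \emph{insertion of a dipole} on a fermionic line with half-edges $x,y$ replaces this line as follows: add two new vertices $a,b$ with half-edges $a_1,\dots,a_q$ and $b_1,\dots,b_q$, a disorder edge $\{a,b\}$ with strands $\{a_i,b_i\}$ for $1\le i\le q$, and fermionic lines $\{x,a_1\}$, $\{y,b_1\}$ and $\{a_i,b_i\}$ for $2\le i\le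 q$. A \emph{melonic graph} is a graph isomorphic to one obtained from $G_{\min}$ by finitely many (possibly zero) dipole insertions on arbitrary fermionic lines. \textbf{Theorem.} Every Feynman graph $G$ of the SYK model satisfies $\delta(G)\le 1$. Moreover, the Feynman graphs $G$ with $\delta(G)=1$ are exactly the melonic graphs (in particular, every melonic graph is a Feynman graph of the SYK model). -/

import Mathlib

universe u v

/-- A Feynman diagram with `q`-valent vertices and stranded disorder edges (no connectedness and
no condition on loops yet). `V` is the set of vertices and `H` the set of fermionic half-edges;
a fermionic line is a pair `{h, line h}`, a disorder edge is a pair `{v, partner v}`, and it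
carries `q` strands, the pairs `{h, strand h}`, which match the half-edges at `v` with those
at `partner v`. -/
structure StrandedGraph (q : ℕ) : Type (u + 1) where
  V : Type u
  H : Type u
  finite_V : Finite V
  finite_H : Finite H
  vert : H → V
  card_vert : ∀ v, Nat.card {h // vert h = v} = q
  line : H → H
  line_line : ∀ h, line (line h) = h
  line_ne : ∀ h, line h ≠ h
  partner : V → V
  partner_partner : ∀ v, partner (partner v) = v
  partner_ne : ∀ v, partner v ≠ v
  strand : H → H
  strand_strand : ∀ h, strand (strand h) = h
  vert_strand : ∀ h, vert (strand h) = partner (vert h)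

namespace StrandedGraph

/-- The (simple graph underlying the) graph `G₀` obtained by deleting the disorder edges. -/
def fermionicGraph {q : ℕ} (G : StrandedGraph.{u} q) : SimpleGraph G.V :=
  SimpleGraph.fromRel fun v w => ∃ h, G.vert h = v ∧ G.vert (G.line h) = w

/-- The Feynman graphs of the SYK model: the graph of the fermionic lines is connected,
and no fermionic line is a loop (tadpole). -/
def IsSYK {q : ℕ} (G : StrandedGraph.{u} q) : Prop :=
  G.fermionicGraph.Connected ∧ ∀ h, G.vert (G.line h) ≠ G.vert h

/-- Faces: the cycles that alternate between fermionic lines and strands. Each half-edge lies on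
exactly one such cycle, so a face is a class of half-edges under the equivalence relation
generated by `h ∼ line h` and `h ∼ strand h`. -/
def Face {q : ℕ} (G : StrandedGraph.{u} q) : Type u :=
  Quot fun h h' : G.H => h' = G.line h ∨ h' = G.strand h

/-- The number of faces `F(G)`. -/
noncomputable def numFaces {q : ℕ} (G : StrandedGraph.{u} q) : ℕ :=
  Nat.card G.Face

/-- The number of vertices `V(G)`. -/
noncomputable def numVertices {q : ℕ} (G : StrandedGraph.{u} q) : ℕ :=
  Nat.card G.V

/-- The SYK degree `δ(G) = F(G) - (q - 1) V(G) / 2`. -/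
noncomputable def degree {q : ℕ} (G : StrandedGraph.{u} q) : ℚ :=
  (G.numFaces : ℚ) - ((q : ℚ) - 1) * (G.numVertices : ℚ) / 2

/-- Isomorphisms of Feynman diagrams. -/
structure Iso {q : ℕ} (G : StrandedGraph.{u} q) (G' : StrandedGraph.{v} q) where
  onV : G.V ≃ G'.V
  onH : G.H ≃ G'.H
  map_vert : ∀ h, G'.vert (onH h) = onV (G.vert h)
  map_line : ∀ h, G'.line (onH h) = onH (G.line h)
  map_partner : ∀ v, G'.partner (onV v) = onV (G.partner v)
  map_strand : ∀ h, G'.strand (onH h) = onH (G.strand h)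

theorem card_fst_eq (q : ℕ) (b : Bool) :
    Nat.card {h : Bool × Fin q // h.1 = b} = q := by
  have e : {h : Bool × Fin q // h.1 = b} ≃ Fin q :=
    { toFun := fun h => h.1.2
      invFun := fun i => ⟨(b, i), rfl⟩
      left_inv := by rintro ⟨⟨c, i⟩, hc⟩; cases hc; rfl
      right_inv := fun i => rfl }
  rw [Nat.card_congr e, Nat.card_fin]

/-- The two-vertex graph `G_min`: two vertices joined by `q` fermionic lines and by a disorder
edge each of whose strands joins the two ends of one fermionic line. -/
def gMin (q : ℕ) : StrandedGraph.{0} q where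
  V := Bool
  H := Bool × Fin q
  finite_V := inferInstance
  finite_H := inferInstance
  vert h := h.1
  card_vert := card_fst_eq q
  line h := (!h.1, h.2)
  line_line := by simp
  line_ne := by rintro ⟨b, i⟩; cases b <;> simp
  partner b := !b
  partner_partner := by simp
  partner_ne := by simp
  strand h := (!h.1, h.2)
  strand_strand := by simp
  vert_strand h := rfl

open Classical in
/-- The fermionic lines after the insertion of a dipole on the line `{x, line x}`; see
`insertDipole`. -/
noncomputable def dipoleLine {q : ℕ} (G : StrandedGraph.{u} q) (x : G.H) (i₀ : Fin q) :
    G.H ⊕ (Bool × Fin q) → G.H ⊕ (Bool × Fin q)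
  | .inl h =>
      if h = x then .inr (false, i₀)
      else if h = G.line x then .inr (true, i₀)
      else .inl (G.line h)
  | .inr (b, i) =>
      if i = i₀ then (if b then .inl (G.line x) else .inl x)
      else .inr (!b, i)

/-- The melonic move: insertion of a dipole on the fermionic line `{x, line x}`. Two new vertices
`false`, `true` are added. The half-edge `x` is joined to the leg `(false, i₀)`, the half-edge
`line x` to the leg `(true, i₀)`, and the other `q - 1` half-edges of the new vertices are joined
to each other by fermionic lines `{(false, i), (true, i)}`. The new vertices are joined by a
disorder edge with strands `{(false, i), (true, i)}` (all `i`). The choice of `i₀` only names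
the legs and does not affect the isomorphism class. -/
noncomputable def insertDipole {q : ℕ} (G : StrandedGraph.{u} q) (x : G.H) (i₀ : Fin q) :
    StrandedGraph.{u} q where
  V := G.V ⊕ Bool
  H := G.H ⊕ (Bool × Fin q)
  finite_V := by have := G.finite_V; infer_instance
  finite_H := by have := G.finite_H; infer_instance
  vert := Sum.map G.vert Prod.fst
  card_vert := by
    rintro (v | b)
    · refine Eq.trans ?_ (G.card_vert v)
      refine (Nat.card_congr
        { toFun := fun h => ⟨.inl h.1, congrArg Sum.inl h.2⟩
          invFun := fun h => match h with
            | ⟨.inl h, hh⟩ => ⟨h, Sum.inl_injective hh⟩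
            | ⟨.inr _, hh⟩ => (Sum.inr_ne_inl hh).elim
          left_inv := fun h => rfl
          right_inv := ?_ }).symm
      rintro ⟨h | h, hh⟩
      · rfl
      · exact (Sum.inr_ne_inl hh).elim
    · refine Eq.trans ?_ (card_fst_eq q b)
      refine (Nat.card_congr
        { toFun := fun h => ⟨.inr h.1, congrArg Sum.inr h.2⟩
          invFun := fun h => match h with
            | ⟨.inr h, hh⟩ => ⟨h, Sum.inr_injective hh⟩
            | ⟨.inl _, hh⟩ => (Sum.inl_ne_inr hh).elim
          left_inv := fun h => rfl
          right_inv := ?_ }).symm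
      rintro ⟨h | h, hh⟩
      · exact (Sum.inl_ne_inr hh).elim
      · rfl
  line := G.dipoleLine x i₀
  line_line := by
    have hx := G.line_ne x
    have hl := G.line_line
    rintro (h | ⟨b, i⟩)
    · by_cases h1 : h = x
      · simp [dipoleLine, h1]
      · by_cases h2 : h = G.line x
        · simp [dipoleLine, h2, hx]
        · have h3 : G.line h ≠ x := fun e => h2 (by rw [← e, hl])
          have h4 : G.line h ≠ G.line x := fun e => h1 (by rw [← hl h, e, hl])
          simp [dipoleLine, h1, h2, h3, h4, hl]
    · by_cases h1 : i = i₀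
      · cases b <;> simp [dipoleLine, h1, hx]
      · simp [dipoleLine, h1]
  line_ne := by
    rintro (h | ⟨b, i⟩)
    · by_cases h1 : h = x
      · simp [dipoleLine, h1]
      · by_cases h2 : h = G.line x
        · simp [dipoleLine, h2, G.line_ne x]
        · simp [dipoleLine, h1, h2, G.line_ne h]
    · by_cases h1 : i = i₀
      · cases b <;> simp [dipoleLine, h1]
      · cases b <;> simp [dipoleLine, h1]
  partner := Sum.map G.partner fun b => !b
  partner_partner := by
    rintro (v | b)
    · simp [G.partner_partner]
    · simp
  partner_ne := by
    rintro (v | b)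
    · simp [G.partner_ne]
    · simp
  strand := Sum.map G.strand fun h => (!h.1, h.2)
  strand_strand := by
    rintro (h | h)
    · simp [G.strand_strand]
    · simp
  vert_strand := by
    rintro (h | h)
    · simp [G.vert_strand]
    · simp

/-- Melonic graphs: the graphs obtained, up to isomorphism, from `G_min` by iterated melonic
moves on arbitrary fermionic lines. -/
inductive IsMelonic {q : ℕ} : StrandedGraph.{u} q → Prop
  | base (G : StrandedGraph.{u} q) (e : Nonempty (Iso G (gMin q))) : IsMelonic G
  | move (G G' : StrandedGraph.{u} q) (x : G.H) (i₀ : Fin q) (hG : IsMelonic G)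
      (e : Nonempty (Iso G' (G.insertDipole x i₀))) : IsMelonic G'

end StrandedGraph

/-!
The proof interpolates between the components of `G₀` and the faces of `G`. A disorder edge is
cut open by deleting its two ends and joining the fermionic lines that end there along its `q`
strands. Once all disorder edges have been cut, only circles are left, and these are the faces.
Restoring the two ends merges the components through the `q` strands into one or two, so a single
cut creates at most `q - 1` new components (`numCut_union_pair_le`). As `G₀` is connected, summing
over the `V / 2` disorder edges gives `F ≤ 1 + (q - 1) V / 2` (`Linked.two_mul_numFaces_le`).

If equality holds, every cut, in whatever order, creates exactly `q - 1` components. Then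
(`of_numCut_union_pair_eq`) the strands of a disorder edge end up in distinct components when it is
cut, and its two ends are never separated by cutting other disorder edges. In particular there is
no tadpole. Among all components created by cutting a single disorder edge, take a largest one,
obtained from the edge `e`. If another component left by cutting `e` contained a vertex, it would
contain a whole disorder edge `f`, and cutting `f` instead of `e` would leave a component that
contains the largest one and also `e`. So the `q - 1` other components are circles without
vertices, which means that `e` is a dipole (`Maximal.exists_isDipole`). Either `G` is `gMin q`, or
the dipole can be removed. Since the insertion of a dipole creates `q - 1` faces and two vertices
and does not affect connectedness (`maximal_insertDipole_iff`), induction on the number of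
vertices shows that `G` is melonic, and the same fact gives the converse.
-/


/-! ### Counting classes when finitely many of them are merged -/

/-- A comparison map between the classes of `s` and those of `u`, when `u` merges at most the
`s`-classes of the points `k i`. Those classes, other than that of `k i₀`, are sent to their
index, and every other class to the `u`-class of a representative. -/
theorem exists_injective_quotient_of_merge {X ι : Type*} (s u : Setoid X) (k : ι → X) (i₀ : ι)
    (h : ∀ x y, u x y → s x y ∨ ((∃ i, s x (k i)) ∧ ∃ i, s y (k i))) :
    ∃ f : Quotient s → Quotient u ⊕ {i // i ≠ i₀}, Function.Injective f ∧
      (∀ c i, f c = .inr i → c = ⟦k i⟧ ∧ c ≠ ⟦k i₀⟧) ∧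
      ∀ c z, f c = .inl z → z = ⟦c.out⟧ ∧ ∀ i, c = ⟦k i⟧ → c = ⟦k i₀⟧ := by
  classical
  let f : Quotient s → Quotient u ⊕ {i // i ≠ i₀} := fun c =>
    if hc : ∃ i : {i // i ≠ i₀}, c = ⟦k i⟧ ∧ c ≠ ⟦k i₀⟧ then .inr hc.choose else .inl ⟦c.out⟧
  have hr : ∀ c i, f c = .inr i → c = ⟦k i⟧ ∧ c ≠ ⟦k i₀⟧ := by
    intro c i hi
    by_cases hc : ∃ i : {i // i ≠ i₀}, c = ⟦k i⟧ ∧ c ≠ ⟦k i₀⟧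
    · simp only [f, dif_pos hc] at hi
      exact Sum.inr_injective hi ▸ hc.choose_spec
    · simp only [f, dif_neg hc, reduceCtorEq] at hi
  have hl : ∀ c z, f c = .inl z → z = ⟦c.out⟧ ∧ ∀ i, c = ⟦k i⟧ → c = ⟦k i₀⟧ := by
    intro c z hz
    by_cases hc : ∃ i : {i // i ≠ i₀}, c = ⟦k i⟧ ∧ c ≠ ⟦k i₀⟧
    · simp only [f, dif_pos hc, reduceCtorEq] at hz
    · simp only [f, dif_neg hc] at hz
      refine ⟨(Sum.inl_injective hz).symm, fun i hi => ?_⟩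
      by_contra hne
      exact hc ⟨⟨i, by rintro rfl; exact hne hi⟩, hi, hne⟩
  refine ⟨f, fun c d hcd => ?_, hr, hl⟩
  rcases hd : f d with z | i
  · obtain ⟨hz, hd'⟩ := hl d z hd
    obtain ⟨hz', hc'⟩ := hl c z (hcd.trans hd)
    rcases h c.out d.out (Quotient.exact (hz'.symm.trans hz)) with hs | ⟨⟨i, hi⟩, j, hj⟩
    · rw [← c.out_eq, ← d.out_eq]; exact Quotient.sound hs
    · rw [hc' i (c.out_eq.symm.trans (Quotient.sound hi)),
        hd' j (d.out_eq.symm.trans (Quotient.sound hj))]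
  · rw [(hr d i hd).1, (hr c i (hcd.trans hd)).1]

theorem card_sum_ne {X ι : Type*} [Finite X] [Finite ι] (i₀ : ι) :
    Nat.card (X ⊕ {i // i ≠ i₀}) = Nat.card X + (Nat.card ι - 1) := by
  classical
  have := Fintype.ofFinite ι
  rw [Nat.card_sum, Nat.card_eq_fintype_card (α := {i // i ≠ i₀}),
    Fintype.card_subtype_compl, Fintype.card_subtype_eq,
    Nat.card_eq_fintype_card (α := ι)]

theorem card_quotient_le_of_merge {X ι : Type*} [Finite X] [Finite ι] (s u : Setoid X)
    (k : ι → X) (i₀ : ι)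
    (h : ∀ x y, u x y → s x y ∨ ((∃ i, s x (k i)) ∧ ∃ i, s y (k i))) :
    Nat.card (Quotient s) ≤ Nat.card (Quotient u) + (Nat.card ι - 1) := by
  obtain ⟨f, hf, -⟩ := exists_injective_quotient_of_merge s u k i₀ h
  exact (Nat.card_le_card_of_injective f hf).trans (card_sum_ne i₀).le

/-- If merging lowers the number of classes as much as it can, then the merged classes were
pairwise distinct, and they are all merged into one. -/
theorem of_card_quotient_eq_of_merge {X ι : Type*} [Finite X] [Finite ι] (s u : Setoid X)
    (k : ι → X) (i₀ : ι)
    (h : ∀ x y, u x y → s x y ∨ ((∃ i, s x (k i)) ∧ ∃ i, s y (k i)))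
    (hcard : Nat.card (Quotient u) + (Nat.card ι - 1) ≤ Nat.card (Quotient s)) :
    (∀ i j, s (k i) (k j) → i = j) ∧ ∀ x y i j, s x (k i) → s y (k j) → u x y := by
  obtain ⟨f, hf, hr, hl⟩ := exists_injective_quotient_of_merge s u k i₀ h
  have hsurj : Function.Surjective f :=
    (hf.bijective_of_nat_card_le ((card_sum_ne i₀).le.trans hcard)).2
  constructor
  · have h₀ : ∀ i, s (k i) (k i₀) → i = i₀ := by
      intro i hi
      by_contra hne
      obtain ⟨c, hc⟩ := hsurj (.inr ⟨i, hne⟩)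
      exact (hr c _ hc).2 ((hr c _ hc).1.trans (Quotient.sound hi))
    intro i j hij
    by_cases hi : i = i₀
    · subst hi; exact (h₀ j (s.symm hij)).symm
    by_cases hj : j = i₀
    · subst hj; exact h₀ i hij
    obtain ⟨c, hc⟩ := hsurj (.inr ⟨i, hi⟩)
    obtain ⟨d, hd⟩ := hsurj (.inr ⟨j, hj⟩)
    have hcd : c = d := by
      rw [(hr c _ hc).1, (hr d _ hd).1]; exact Quotient.sound hij
    rw [hcd, hd] at hc
    exact (congrArg Subtype.val (Sum.inr_injective hc)).symm
  · -- The only class of `s` that can be sent to the `u`-class of a merged point is that of `k i₀`.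
    have key : ∀ x i, s x (k i) →
        (⟦x⟧ : Quotient u) = ⟦(⟦k i₀⟧ : Quotient s).out⟧ := by
      intro x i hi
      obtain ⟨c, hc⟩ := hsurj (.inl ⟦x⟧)
      obtain ⟨hx, hc'⟩ := hl c _ hc
      have : ∃ j, s c.out (k j) := by
        rcases h _ _ (Quotient.exact hx) with hs | hs
        · exact ⟨i, s.trans (s.symm hs) hi⟩
        · exact hs.2
      obtain ⟨j, hj⟩ := this
      rw [hx, ← hc' j (c.out_eq.symm.trans (Quotient.sound hj))]
    intro x y i j hx hy
    exact Quotient.exact ((key x i hx).trans (key y j hy).symm)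

namespace StrandedGraph

variable {q : ℕ} {G : StrandedGraph.{u} q}

/-! ### Cutting open disorder edges -/

/-- The equivalence relation on half-edges whose classes are the connected components of the
graph obtained from `G₀` by deleting the vertices of `S` and joining the ends of the lines left
open along the strands. Closed circles without any vertex count as components. -/
def cut (G : StrandedGraph.{u} q) (S : Set G.V) : Setoid G.H :=
  Relation.EqvGen.setoid fun h h' =>
    h' = G.line h ∨ (G.vert h ∈ S ∧ h' = G.strand h) ∨ (G.vert h ∉ S ∧ G.vert h = G.vert h')

/-- The number of components after the vertices of `S` have been cut open. -/
noncomputable def numCut (G : StrandedGraph.{u} q) (S : Set G.V) : ℕ :=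
  Nat.card (Quotient (G.cut S))

/-- The two ends of the disorder edge at `v`. -/
def pair (G : StrandedGraph.{u} q) (v : G.V) : Set G.V := {v, G.partner v}

/-- Any two half-edges are joined by a path of fermionic lines, and there is one. -/
def Linked (G : StrandedGraph.{u} q) : Prop :=
  Nonempty G.H ∧ ∀ x y, G.cut ∅ x y

variable {S : Set G.V}

theorem cut_line (S : Set G.V) (h : G.H) : G.cut S h (G.line h) :=
  .rel _ _ (.inl rfl)

theorem cut_strand {h : G.H} (hS : G.vert h ∈ S) : G.cut S h (G.strand h) :=
  .rel _ _ (.inr (.inl ⟨hS, rfl⟩))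

theorem cut_vert {h h' : G.H} (hS : G.vert h ∉ S) (e : G.vert h = G.vert h') : G.cut S h h' :=
  .rel _ _ (.inr (.inr ⟨hS, e⟩))

/-- The induction principle for `cut`: the relation is the least equivalence relation with the
three generating properties. -/
theorem cut_le {t : Setoid G.H} (h₁ : ∀ h, t h (G.line h))
    (h₂ : ∀ h, G.vert h ∈ S → t h (G.strand h))
    (h₃ : ∀ h h', G.vert h ∉ S → G.vert h = G.vert h' → t h h') : G.cut S ≤ t := by
  refine Setoid.eqvGen_le ?_
  rintro h h' (rfl | ⟨hS, rfl⟩ | ⟨hS, e⟩)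
  exacts [h₁ h, h₂ h hS, h₃ h h' hS e]

theorem numCut_univ : G.numCut Set.univ = G.numFaces := by
  refine Nat.card_congr (Equiv.symm ?_)
  refine
    { toFun := Quot.lift (fun h => ⟦h⟧) ?_
      invFun := Quotient.lift (fun h => Quot.mk _ h) ?_
      left_inv := by rintro ⟨h⟩; rfl
      right_inv := by rintro ⟨h⟩; rfl }
  · rintro h h' (rfl | rfl)
    · exact Quotient.sound (cut_line _ h)
    · exact Quotient.sound (cut_strand trivial)
  · intro a b hab
    refine cut_le (t := Setoid.ker fun h : G.H => (Quot.mk _ h : G.Face))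
      (fun h => Quot.sound (.inl rfl)) (fun h _ => Quot.sound (.inr rfl))
      (fun h h' hS => (hS (Set.mem_univ _)).elim) hab

theorem partner_mem_pair {v z : G.V} (hz : z ∈ G.pair v) : G.partner z ∈ G.pair v := by
  rcases hz with rfl | rfl
  · exact .inr rfl
  · exact .inl (G.partner_partner v)

theorem partner_notMem_pair {v z : G.V} (hz : z ∉ G.pair v) : G.partner z ∉ G.pair v :=
  fun h => hz (G.partner_partner z ▸ partner_mem_pair h)

/-- A component on which a half-edge of the cut disorder edge lies contains one of its strands. -/
theorem exists_cut_of_mem_pair {v : G.V} {x : G.H} (hS : G.pair v ⊆ S)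
    (hx : G.vert x ∈ G.pair v) : ∃ k : {h // G.vert h = v}, G.cut S x k := by
  rcases hx with hx | hx
  · exact ⟨⟨x, hx⟩, (G.cut S).refl x⟩
  · exact ⟨⟨G.strand x, by rw [G.vert_strand, hx, G.partner_partner]⟩,
      cut_strand (hS (.inr hx))⟩

/-- Leaving a disorder edge uncut only merges components that contain one of its strands. -/
theorem cut_merge (S : Set G.V) (v : G.V) (x y : G.H) (hxy : G.cut S x y) :
    G.cut (S ∪ G.pair v) x y ∨
      ((∃ k : {h // G.vert h = v}, G.cut (S ∪ G.pair v) x k) ∧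
        ∃ k : {h // G.vert h = v}, G.cut (S ∪ G.pair v) y k) := by
  have hsub : G.pair v ⊆ S ∪ G.pair v := Set.subset_union_right
  set s := G.cut (S ∪ G.pair v) with hs
  induction hxy with
  | rel x y h =>
    rcases h with rfl | ⟨hS, rfl⟩ | ⟨hS, e⟩
    · exact .inl (cut_line _ x)
    · exact .inl (cut_strand (.inl hS))
    · by_cases hv : G.vert x ∈ G.pair v
      · exact .inr ⟨exists_cut_of_mem_pair hsub hv, exists_cut_of_mem_pair hsub (e ▸ hv)⟩
      · exact .inl (cut_vert (by rintro (h | h) <;> contradiction) e)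
  | refl x => exact .inl (s.refl x)
  | symm x y _ ih => exact ih.imp s.symm And.symm
  | trans x y z _ _ ih₁ ih₂ =>
    rcases ih₁ with h₁ | ⟨hx, k, hk⟩
    · rcases ih₂ with h₂ | ⟨⟨k, hk⟩, hz⟩
      · exact .inl (s.trans h₁ h₂)
      · exact .inr ⟨⟨k, s.trans h₁ hk⟩, hz⟩
    · rcases ih₂ with h₂ | ⟨-, hz⟩
      · exact .inr ⟨hx, k, s.trans (s.symm h₂) hk⟩
      · exact .inr ⟨hx, hz⟩

theorem exists_vert_eq (hq : 0 < q) (v : G.V) : ∃ h, G.vert h = v := by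
  have := G.card_vert v
  have h : 0 < Nat.card {h // G.vert h = v} := by omega
  exact ⟨_, (Nat.card_pos_iff.1 h).1.some.2⟩

theorem numCut_union_pair_le (hq : 0 < q) (S : Set G.V) (v : G.V) :
    G.numCut (S ∪ G.pair v) ≤ G.numCut S + (q - 1) := by
  have := G.finite_H
  obtain ⟨h₀, hh₀⟩ := exists_vert_eq hq v
  have := card_quotient_le_of_merge _ _ (fun k : {h // G.vert h = v} => k.1) ⟨h₀, hh₀⟩
    (cut_merge S v)
  rwa [G.card_vert v] at this

/-- When cutting a disorder edge creates as many components as possible, its `q` strands end up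
in distinct components, and both of its ends were in the same component before. -/
theorem of_numCut_union_pair_eq (hq : 0 < q) {v : G.V}
    (hc : G.numCut S + (q - 1) ≤ G.numCut (S ∪ G.pair v)) :
    (∀ h h', G.vert h = v → G.vert h' = v → G.cut (S ∪ G.pair v) h h' → h = h') ∧
      ∀ x y, G.vert x ∈ G.pair v → G.vert y ∈ G.pair v → G.cut S x y := by
  have := G.finite_H
  obtain ⟨h₀, hh₀⟩ := exists_vert_eq hq v
  obtain ⟨h₁, h₂⟩ := of_card_quotient_eq_of_merge _ _ (fun k : {h // G.vert h = v} => k.1)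
    ⟨h₀, hh₀⟩ (cut_merge S v) (by rwa [G.card_vert v])
  refine ⟨fun h h' e e' hh => congrArg Subtype.val (h₁ ⟨h, e⟩ ⟨h', e'⟩ hh), fun x y hx hy => ?_⟩
  obtain ⟨i, hi⟩ := exists_cut_of_mem_pair (Set.subset_union_right (s := S)) hx
  obtain ⟨j, hj⟩ := exists_cut_of_mem_pair (Set.subset_union_right (s := S)) hy
  exact h₂ x y i j hi hj

theorem ncard_pair (v : G.V) : (G.pair v).ncard = 2 :=
  Set.ncard_pair (G.partner_ne v).symm

/-- Cutting the disorder edges that are still uncut, one after the other, leads to the faces. -/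
theorem two_mul_numFaces_le (hq : 0 < q) (n : ℕ) :
    ∀ S : Set G.V, (∀ v ∈ S, G.partner v ∈ S) → Sᶜ.ncard = n →
      2 * G.numFaces ≤ 2 * G.numCut S + (q - 1) * Sᶜ.ncard := by
  have := G.finite_V
  induction n using Nat.strong_induction_on with
  | _ n ih =>
    intro S hS hn
    rcases Sᶜ.eq_empty_or_nonempty with h | ⟨v, hv⟩
    · rw [← numCut_univ, Set.compl_empty_iff.1 h]; omega
    have hsub : G.pair v ⊆ Sᶜ := by
      rintro z (rfl | rfl)
      · exact hv
      · intro h; exact hv (G.partner_partner v ▸ hS _ h)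
    have hcard : (S ∪ G.pair v)ᶜ.ncard + 2 = Sᶜ.ncard := by
      rw [← G.ncard_pair v, ← Set.ncard_sdiff_add_ncard_of_subset hsub, Set.compl_union,
        Set.sdiff_eq]
    have h₁ := ih _ (by omega) (S ∪ G.pair v) (by
      rintro z (h | h)
      · exact .inl (hS z h)
      · exact .inr (partner_mem_pair h)) rfl
    have h₂ := numCut_union_pair_le hq S v
    rw [← hcard, mul_add]
    omega

/-! ### Graphs with the largest number of faces -/

theorem Linked.numCut_empty (hG : G.Linked) : G.numCut ∅ = 1 := by
  rw [numCut, Nat.card_eq_one_iff_unique]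
  refine ⟨⟨?_⟩, hG.1.map fun h => ⟦h⟧⟩
  rintro ⟨x⟩ ⟨y⟩
  exact Quotient.sound (hG.2 x y)

theorem Linked.two_mul_numFaces_le (hq : 0 < q) (hG : G.Linked) :
    2 * G.numFaces ≤ 2 + (q - 1) * G.numVertices := by
  have := G.two_mul_numFaces_le hq _ ∅ (by simp) rfl
  rwa [hG.numCut_empty, Set.compl_empty, Set.ncard_univ] at this

theorem linked_iff (hq : 0 < q) : G.Linked ↔ G.fermionicGraph.Connected := by
  constructor
  · rintro ⟨⟨h₀⟩, hG⟩
    refine (SimpleGraph.connected_iff _).2 ⟨fun v w => ?_, ⟨G.vert h₀⟩⟩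
    obtain ⟨x, rfl⟩ := exists_vert_eq hq v
    obtain ⟨y, rfl⟩ := exists_vert_eq hq w
    refine cut_le (t := G.fermionicGraph.reachableSetoid.comap G.vert) (fun h => ?_)
      (fun h hh => hh.elim) (fun h h' _ e => ?_) (hG x y)
    · change G.fermionicGraph.Reachable _ _
      by_cases e : G.vert h = G.vert (G.line h)
      · rw [← e]
      · exact SimpleGraph.Adj.reachable
          ((SimpleGraph.fromRel_adj _ _ _).2 ⟨e, .inl ⟨h, rfl, rfl⟩⟩)
    · change G.fermionicGraph.Reachable _ _
      rw [e]
  · intro hG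
    obtain ⟨v₀⟩ := hG.nonempty
    refine ⟨⟨(exists_vert_eq hq v₀).choose⟩, fun x y => ?_⟩
    have same {x y : G.H} (e : G.vert x = G.vert y) : G.cut ∅ x y :=
      cut_vert (Set.notMem_empty _) e
    obtain ⟨p⟩ := hG.preconnected (G.vert x) (G.vert y)
    generalize hv : G.vert x = v at p
    generalize hw : G.vert y = w at p
    induction p generalizing x with
    | nil => exact same (hv.trans hw.symm)
    | cons hadj p ih =>
      obtain ⟨-, ⟨h, h₁, h₂⟩ | ⟨h, h₁, h₂⟩⟩ := (SimpleGraph.fromRel_adj _ _ _).1 hadj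
      · exact (G.cut ∅).trans (same (hv.trans h₁.symm))
          ((G.cut ∅).trans (cut_line _ h) (ih _ h₂ hw))
      · exact (G.cut ∅).trans (same (hv.trans h₂.symm))
          ((G.cut ∅).trans ((G.cut ∅).symm (cut_line _ h)) (ih _ h₁ hw))

/-- The connected graphs whose number of faces reaches the upper bound of
`Linked.two_mul_numFaces_le`. Tadpoles are not excluded here; see `Maximal.vert_line_ne`. -/
def Maximal (G : StrandedGraph.{u} q) : Prop :=
  G.Linked ∧ 2 * G.numFaces = 2 + (q - 1) * G.numVertices

/-- The lines at the disorder edge through `h`, except possibly those at the ends of the strand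
of `h`, run parallel to its strands. -/
def IsDipole (h : G.H) : Prop :=
  ∀ k, G.vert k = G.vert h → k ≠ h → G.line k = G.strand k

theorem degree_le_one_iff (hq : 0 < q) :
    G.degree ≤ 1 ↔ 2 * G.numFaces ≤ 2 + (q - 1) * G.numVertices := by
  rw [← Nat.cast_le (α := ℚ), degree]
  push_cast [Nat.cast_sub (show 1 ≤ q from hq)]
  constructor <;> intro h <;> linarith

theorem degree_eq_one_iff (hq : 0 < q) :
    G.degree = 1 ↔ 2 * G.numFaces = 2 + (q - 1) * G.numVertices := by
  rw [← Nat.cast_inj (R := ℚ), degree]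
  push_cast [Nat.cast_sub (show 1 ≤ q from hq)]
  constructor <;> intro h <;> linarith

namespace Maximal

/-- In a graph with the largest number of faces, cutting any set of disorder edges creates as many
components as possible. -/
theorem numCut_le (hq : 0 < q) (hG : G.Maximal) (hS : ∀ v ∈ S, G.partner v ∈ S) :
    2 + (q - 1) * S.ncard ≤ 2 * G.numCut S := by
  have := G.finite_V
  have h₁ := G.two_mul_numFaces_le hq _ S hS rfl
  rw [hG.2, numVertices, ← Set.ncard_add_ncard_compl S, mul_add] at h₁
  omega

theorem numCut_pair (hq : 0 < q) (hG : G.Maximal) (v : G.V) :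
    G.numCut (G.pair v) = 1 + (q - 1) := by
  have h₁ := hG.numCut_le hq (S := G.pair v) fun _ => partner_mem_pair
  have h₂ := numCut_union_pair_le hq ∅ v
  rw [Set.empty_union, hG.1.numCut_empty] at h₂
  rw [ncard_pair] at h₁
  omega

/-- The strands of a disorder edge lie in distinct components once this edge is cut. -/
theorem eq_of_cut_pair (hq : 0 < q) (hG : G.Maximal) {h h' : G.H}
    (e : G.vert h = G.vert h') (hh : G.cut (G.pair (G.vert h)) h h') : h = h' := by
  have := of_numCut_union_pair_eq (S := ∅) hq (v := G.vert h) (by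
    rw [Set.empty_union, hG.1.numCut_empty, hG.numCut_pair hq])
  rw [Set.empty_union] at this
  exact this.1 h h' rfl e.symm hh

/-- Every component left by cutting a disorder edge of a connected graph contains one of its
strands. -/
theorem exists_cut_pair (hq : 0 < q) (hG : G.Maximal) (v : G.V) (x : G.H) :
    ∃ h, G.vert h = v ∧ G.cut (G.pair v) x h := by
  obtain ⟨h₀, rfl⟩ := exists_vert_eq hq v
  rcases cut_merge ∅ (G.vert h₀) x h₀ (hG.1.2 _ _) with h | ⟨⟨k, hk⟩, -⟩
  · exact ⟨h₀, rfl, by rwa [Set.empty_union] at h⟩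
  · exact ⟨k.1, k.2, by rwa [Set.empty_union] at hk⟩

/-- Cutting one disorder edge does not separate the ends of another one. -/
theorem cut_pair_of_notMem (hq : 0 < q) (hG : G.Maximal) {v w : G.V} (hw : w ∉ G.pair v)
    {x y : G.H} (hx : G.vert x ∈ G.pair w) (hy : G.vert y ∈ G.pair w) :
    G.cut (G.pair v) x y := by
  have := G.finite_V
  refine (of_numCut_union_pair_eq hq (v := w) ?_).2 x y hx hy
  have h₁ := hG.numCut_le hq (S := G.pair v ∪ G.pair w) (by
    rintro z (h | h)
    · exact .inl (partner_mem_pair h)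
    · exact .inr (partner_mem_pair h))
  have hd : Disjoint (G.pair v) (G.pair w) := by
    refine Set.disjoint_left.2 ?_
    rintro z hz (rfl | rfl)
    · exact hw hz
    · exact hw (G.partner_partner w ▸ partner_mem_pair hz)
  rw [Set.ncard_union_eq hd, ncard_pair, ncard_pair] at h₁
  rw [hG.numCut_pair hq]
  omega

/-- A tadpole would join two strands of the disorder edge at its vertex. -/
theorem vert_line_ne (hq : 0 < q) (hG : G.Maximal) (h : G.H) : G.vert (G.line h) ≠ G.vert h :=
  fun e => G.line_ne h (hG.eq_of_cut_pair hq e.symm (cut_line _ h)).symm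

/-- A component of largest size, among all the components obtained by cutting one disorder edge,
is separated by a dipole from the rest. Otherwise another of the `q` components contains a
disorder edge, and cutting the latter instead leaves a component that is larger. -/
theorem exists_isDipole (hq : 0 < q) (hG : G.Maximal) : ∃ h : G.H, IsDipole h := by
  have := G.finite_H
  obtain ⟨h₀⟩ := hG.1.1
  obtain ⟨h, hmax⟩ :=
    (Set.finite_univ (α := G.H)).exists_maximalFor
      (fun h : G.H => {x | G.cut (G.pair (G.vert h)) h x}.ncard) _ ⟨h₀, trivial⟩
  refine ⟨h, fun k hk hne => ?_⟩
  by_contra hline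
  set v := G.vert h with hv
  set u := G.vert (G.line k) with hu
  have hvk : ¬ G.cut (G.pair v) h k := fun e => hne (hG.eq_of_cut_pair hq hk.symm e).symm
  -- The line at `k` leaves the disorder edge at `v`.
  have huv : u ∉ G.pair v := by
    rintro (e | e)
    · exact hG.vert_line_ne hq k (e.trans hk.symm)
    · refine hline ?_
      have hs : G.vert (G.strand (G.line k)) = v := by
        rw [G.vert_strand, ← hu, e, G.partner_partner]
      have := hG.eq_of_cut_pair hq (hk.trans hs.symm)
        (hk.symm ▸ (G.cut _).trans (cut_line _ k) (cut_strand (.inr (hk.symm ▸ e))))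
      rw [this, G.strand_strand, ← this]
  have hvu : v ∉ G.pair u := by
    rintro (e | e)
    · exact huv (.inl e.symm)
    · exact huv (.inr (by rw [show v = G.partner u from e, G.partner_partner]; rfl))
  -- The component of `h` does not meet the disorder edge at `u`, so no connection inside it is
  -- lost when that edge is cut instead; `v` and its partner remain connected to each other.
  have hle : ∀ x, G.cut (G.pair v) h x → G.cut (G.pair u) h x := by
    let t : Setoid G.H :=
      { r := fun x y => G.cut (G.pair v) x y ∧ (G.cut (G.pair v) h x → G.cut (G.pair u) x y)
        iseqv :=
          { refl := fun x => ⟨(G.cut _).refl x, fun _ => (G.cut _).refl x⟩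
            symm := fun {x y} hxy => ⟨(G.cut _).symm hxy.1, fun hy =>
              (G.cut _).symm (hxy.2 ((G.cut _).trans hy ((G.cut _).symm hxy.1)))⟩
            trans := fun {x y z} hxy hyz => ⟨(G.cut _).trans hxy.1 hyz.1, fun hx =>
              (G.cut _).trans (hxy.2 hx) (hyz.2 ((G.cut _).trans hx hxy.1))⟩ } }
    have hst : G.cut (G.pair v) ≤ t := by
      refine cut_le (fun x => ⟨cut_line _ x, fun _ => cut_line _ x⟩)
        (fun x hx => ⟨cut_strand hx, fun _ => hG.cut_pair_of_notMem hq hvu hx ?_⟩)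
        (fun x y hx e => ⟨cut_vert hx e, fun hhx => ?_⟩)
      · rw [G.vert_strand]; exact partner_mem_pair hx
      · refine cut_vert (fun hxu => hvk ?_) e
        exact (G.cut _).trans hhx ((G.cut _).trans
          (hG.cut_pair_of_notMem hq huv hxu (.inl rfl)) ((G.cut _).symm (cut_line _ k)))
    exact fun x hx => (hst hx).2 ((G.cut _).refl h)
  -- The component of `h` after cutting at `u` is larger, since it contains `k` too.
  obtain ⟨h', hh', hc⟩ := hG.exists_cut_pair hq u h
  have hlt : {x | G.cut (G.pair v) h x}.ncard < {x | G.cut (G.pair (G.vert h')) h' x}.ncard := by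
    rw [hh']
    refine Set.ncard_lt_ncard (Set.ssubset_iff_of_subset ?_ |>.2 ⟨k, ?_, hvk⟩) (Set.toFinite _)
    · exact fun x hx => (G.cut _).trans ((G.cut _).symm hc) (hle x hx)
    · exact (G.cut _).trans ((G.cut _).symm hc)
        (hG.cut_pair_of_notMem hq hvu (.inl rfl) (.inl hk))
  exact absurd (hmax.2 (Set.mem_univ h') hlt.le) (not_le.2 hlt)

end Maximal

/-! ### Isomorphisms -/

namespace Iso

variable {G' : StrandedGraph.{v} q}

/-- The inverse of an isomorphism. -/
def symm (e : Iso G G') : Iso G' G where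
  onV := e.onV.symm
  onH := e.onH.symm
  map_vert h := by rw [Equiv.eq_symm_apply, ← e.map_vert, Equiv.apply_symm_apply]
  map_line h := by rw [Equiv.eq_symm_apply, ← e.map_line, Equiv.apply_symm_apply]
  map_partner h := by rw [Equiv.eq_symm_apply, ← e.map_partner, Equiv.apply_symm_apply]
  map_strand h := by rw [Equiv.eq_symm_apply, ← e.map_strand, Equiv.apply_symm_apply]

theorem numVertices_eq (e : Iso G G') : G.numVertices = G'.numVertices :=
  Nat.card_congr e.onV

theorem numFaces_eq (e : Iso G G') : G.numFaces = G'.numFaces := by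
  refine Nat.card_congr (Quot.congr e.onH fun a b => ?_)
  rw [e.map_line, e.map_strand, e.onH.injective.eq_iff, e.onH.injective.eq_iff]

theorem linked (e : Iso G G') (hG : G.Linked) : G'.Linked := by
  refine ⟨hG.1.map e.onH, fun x y => ?_⟩
  have : G.cut ∅ ≤ (G'.cut ∅).comap e.onH := by
    refine cut_le (fun h => ?_) (fun h hh => hh.elim) (fun h h' _ hh => ?_)
    · change G'.cut ∅ _ _
      rw [← e.map_line]
      exact cut_line _ _
    · exact cut_vert (Set.notMem_empty _) (by rw [e.map_vert, e.map_vert, hh])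
  have h := this (hG.2 (e.onH.symm x) (e.onH.symm y))
  change G'.cut ∅ _ _ at h
  rwa [e.onH.apply_symm_apply, e.onH.apply_symm_apply] at h

theorem maximal (e : Iso G G') (hG : G.Maximal) : G'.Maximal :=
  ⟨e.linked hG.1, by rw [← e.numFaces_eq, ← e.numVertices_eq]; exact hG.2⟩

end Iso

/-! ### Dipole insertions -/

theorem maximal_gMin (hq : 0 < q) : (gMin q).Maximal := by
  have hF : (gMin q).numFaces = q := by
    refine (Nat.card_congr (Equiv.symm ?_)).trans (Nat.card_fin q)
    refine
      { toFun := fun i => Quot.mk _ (false, i)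
        invFun := Quot.lift (fun h : Bool × Fin q => h.2) ?_
        left_inv := fun i => rfl
        right_inv := ?_ }
    · rintro h h' (rfl | rfl) <;> rfl
    · rintro ⟨⟨b, i⟩⟩
      cases b
      · rfl
      · exact Quot.sound (.inl rfl)
  have hV : (gMin q).numVertices = 2 := by
    change Nat.card Bool = 2
    simp
  refine ⟨⟨⟨(false, ⟨0, hq⟩)⟩, ?_⟩, by rw [hF, hV]; omega⟩
  have h₀ : ∀ x : (gMin q).H, (gMin q).cut ∅ x ((false, ⟨0, hq⟩) : Bool × Fin q) := by
    have hf : ∀ i : Fin q, (gMin q).cut ∅ ((false, i) : Bool × Fin q)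
        ((false, ⟨0, hq⟩) : Bool × Fin q) := fun i => cut_vert (Set.notMem_empty _) rfl
    rintro ⟨b, i⟩
    cases b
    · exact hf i
    · exact ((gMin q).cut ∅).trans (cut_line _ _) (hf i)
  exact fun x y => ((gMin q).cut ∅).trans (h₀ x) (((gMin q).cut ∅).symm (h₀ y))

section InsertDipole

variable (x : G.H) (i₀ : Fin q)

theorem line_inl_self : (G.insertDipole x i₀).line (.inl x) = .inr (false, i₀) :=
  if_pos rfl

theorem line_inl_line : (G.insertDipole x i₀).line (.inl (G.line x)) = .inr (true, i₀) :=
  (if_neg (G.line_ne x)).trans (if_pos rfl)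

theorem line_inl_of_ne {h : G.H} (h₁ : h ≠ x) (h₂ : h ≠ G.line x) :
    (G.insertDipole x i₀).line (.inl h) = .inl (G.line h) :=
  (if_neg h₁).trans (if_neg h₂)

theorem line_inr_false : (G.insertDipole x i₀).line (.inr (false, i₀)) = .inl x :=
  (if_pos rfl).trans (if_neg Bool.false_ne_true)

theorem line_inr_true : (G.insertDipole x i₀).line (.inr (true, i₀)) = .inl (G.line x) :=
  (if_pos rfl).trans (if_pos rfl)

theorem line_inr_of_ne (b : Bool) {i : Fin q} (hi : i ≠ i₀) :
    (G.insertDipole x i₀).line (.inr (b, i)) = .inr (!b, i) :=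
  if_neg hi

theorem numVertices_insertDipole :
    (G.insertDipole x i₀).numVertices = G.numVertices + 2 := by
  have := G.finite_V
  change Nat.card (G.V ⊕ Bool) = _
  rw [Nat.card_sum]
  simp [numVertices]

/-- The face through the line `x` is lengthened, and every other leg of the dipole is a new
face. -/
theorem numFaces_insertDipole :
    (G.insertDipole x i₀).numFaces = G.numFaces + (q - 1) := by
  have := G.finite_H
  have : Finite G.Face := Quot.finite _
  let D := G.insertDipole x i₀
  let φ : D.H → G.Face ⊕ {i // i ≠ i₀} := Sum.elim (fun h => .inl (Quot.mk _ h))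
    fun p => if hp : p.2 = i₀ then .inl (Quot.mk _ x) else .inr ⟨p.2, hp⟩
  have φ_self (b : Bool) : φ (.inr (b, i₀)) = φ (.inl x) := dif_pos rfl
  have φ_ne (b : Bool) {i : Fin q} (hi : i ≠ i₀) : φ (.inr (b, i)) = .inr ⟨i, hi⟩ := dif_neg hi
  have hφ : ∀ h h', h' = D.line h ∨ h' = D.strand h → φ h = φ h' := by
    have hy : φ (.inl (G.line x)) = φ (.inl x) :=
      congrArg Sum.inl (Quot.sound (.inl (G.line_line x).symm))
    rintro h _ (rfl | rfl)
    · rcases h with h | ⟨b, i⟩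
      · by_cases h₁ : h = x
        · rw [h₁, line_inl_self, φ_self]
        by_cases h₂ : h = G.line x
        · rw [h₂, line_inl_line, φ_self, hy]
        · rw [line_inl_of_ne _ _ h₁ h₂]
          exact congrArg Sum.inl (Quot.sound (.inl rfl))
      · by_cases hi : i = i₀
        · rw [hi, φ_self]
          cases b
          · rw [line_inr_false]
          · rw [line_inr_true, hy]
        · rw [line_inr_of_ne _ _ b hi, φ_ne _ hi, φ_ne _ hi]
    · rcases h with h | ⟨b, i⟩
      · exact congrArg Sum.inl (Quot.sound (.inr rfl))
      · rfl
  let mk (h : D.H) : D.Face := Quot.mk _ h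
  have face {h h' : D.H} (e : h' = D.line h ∨ h' = D.strand h) : mk h = mk h' := Quot.sound e
  have hb : ∀ b i, mk (.inr (false, i)) = mk (.inr (b, i)) := by
    rintro (_ | _) i
    · rfl
    · exact face (.inr rfl)
  have hx : mk (.inl x) = mk (.inr (false, i₀)) := face (.inl (line_inl_self x i₀).symm)
  -- The old face through `x` runs along the strand `i₀` of the new disorder edge.
  have hxy : mk (.inl x) = mk (.inl (G.line x)) :=
    (hx.trans (hb true i₀)).trans (face (.inl (line_inr_true x i₀).symm))
  let ψ : G.Face ⊕ {i // i ≠ i₀} → D.Face :=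
    Sum.elim (Quot.lift (fun h => mk (.inl h)) (by
      rintro h _ (rfl | rfl)
      · by_cases h₁ : h = x
        · rw [h₁]; exact hxy
        by_cases h₂ : h = G.line x
        · rw [h₂, G.line_line]; exact hxy.symm
        · exact face (.inl (line_inl_of_ne _ _ h₁ h₂).symm)
      · exact face (.inr rfl))) fun i => mk (.inr (false, i.1))
  let e : D.Face ≃ G.Face ⊕ {i // i ≠ i₀} :=
    { toFun := Quot.lift φ hφ
      invFun := ψ
      left_inv := by
        rintro ⟨h | ⟨b, i⟩⟩
        · rfl
        · change ψ (φ _) = mk _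
          by_cases hi : i = i₀
          · rw [hi, φ_self]
            exact hx.trans (hb b i₀)
          · rw [φ_ne b hi]
            exact hb b i
      right_inv := by
        rintro (⟨⟨h⟩⟩ | ⟨i, hi⟩)
        · rfl
        · exact φ_ne false hi }
  rw [numFaces, Nat.card_congr e, card_sum_ne, Nat.card_fin, numFaces]

theorem linked_insertDipole_iff (hq : 2 ≤ q) : (G.insertDipole x i₀).Linked ↔ G.Linked := by
  let D := G.insertDipole x i₀
  constructor
  · intro hD
    refine ⟨⟨x⟩, fun y z => ?_⟩
    have hle : D.cut ∅ ≤ (G.cut ∅).comap (Sum.elim id fun _ => x : D.H → G.H) := by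
      refine cut_le (fun h => ?_) (fun h hh => hh.elim) ?_
      · change G.cut ∅ _ _
        rcases h with h | ⟨b, i⟩
        · by_cases h₁ : h = x
          · subst h₁
            rw [line_inl_self]; exact (G.cut ∅).refl _
          by_cases h₂ : h = G.line x
          · subst h₂
            rw [line_inl_line]; exact (G.cut ∅).symm (cut_line _ x)
          · rw [line_inl_of_ne _ _ h₁ h₂]; exact cut_line _ h
        · by_cases hi : i = i₀
          · subst hi
            cases b
            · rw [line_inr_false]; exact (G.cut ∅).refl _
            · rw [line_inr_true]; exact cut_line _ x
          · rw [line_inr_of_ne _ _ b hi]; exact (G.cut ∅).refl _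
      · rintro (h | h) (h' | h') - e
        · exact cut_vert (Set.notMem_empty _) (Sum.inl_injective e)
        · exact (Sum.inl_ne_inr e).elim
        · exact (Sum.inr_ne_inl e).elim
        · exact (G.cut ∅).refl _
    exact hle (hD.2 (.inl y) (.inl z))
  · intro hG
    have same {h h' : D.H} (e : D.vert h = D.vert h') : D.cut ∅ h h' :=
      cut_vert (Set.notMem_empty _) e
    have : Nontrivial (Fin q) := Fin.nontrivial_iff_two_le.2 hq
    obtain ⟨i₁, hi₁⟩ := exists_ne i₀
    -- The two new vertices are joined by the line through any leg other than `i₀`.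
    have hnew : ∀ b i, D.cut ∅ (.inr (b, i)) (.inr (false, i₀)) := by
      rintro (_ | _) i
      · exact same rfl
      · refine (D.cut ∅).trans (same (h' := .inr (true, i₁)) rfl) ((D.cut ∅).trans
          (cut_line _ _) ?_)
        rw [line_inr_of_ne _ _ _ hi₁]
        exact same rfl
    have hx : D.cut ∅ (.inl x) (.inr (false, i₀)) := by
      rw [← line_inl_self x i₀]; exact cut_line _ _
    have hxy : D.cut ∅ (.inl x) (.inl (G.line x)) := by
      refine (D.cut ∅).trans hx ((D.cut ∅).trans ((D.cut ∅).symm (hnew true i₀)) ?_)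
      rw [← line_inr_true x i₀]; exact cut_line _ _
    have hle : G.cut ∅ ≤ (D.cut ∅).comap Sum.inl := by
      refine cut_le (fun h => ?_) (fun h hh => hh.elim)
        (fun h h' _ e => same (congrArg Sum.inl e))
      change D.cut ∅ _ _
      by_cases h₁ : h = x
      · subst h₁; exact hxy
      by_cases h₂ : h = G.line x
      · subst h₂; rw [G.line_line]; exact (D.cut ∅).symm hxy
      · rw [← line_inl_of_ne x i₀ h₁ h₂]; exact cut_line _ _
    have hall : ∀ h : D.H, D.cut ∅ h (.inl x) := by
      rintro (h | ⟨b, i⟩)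
      · exact hle (hG.2 h x)
      · exact (D.cut ∅).trans (hnew b i) ((D.cut ∅).symm hx)
    exact ⟨⟨.inl x⟩, fun y z => (D.cut ∅).trans (hall y) ((D.cut ∅).symm (hall z))⟩

theorem maximal_insertDipole_iff (hq : 2 ≤ q) :
    (G.insertDipole x i₀).Maximal ↔ G.Maximal := by
  rw [Maximal, Maximal, linked_insertDipole_iff x i₀ hq, numFaces_insertDipole,
    numVertices_insertDipole, mul_add (q - 1)]
  exact and_congr_right fun _ => by omega

end InsertDipole

theorem IsMelonic.maximal (hq : 2 ≤ q) (hG : G.IsMelonic) : G.Maximal := by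
  induction hG with
  | base G e => exact e.some.symm.maximal (maximal_gMin (by omega))
  | move G G' x i₀ _ e ih => exact e.some.symm.maximal ((maximal_insertDipole_iff x i₀ hq).2 ih)

/-! ### Removal of a dipole -/

section Leg

variable {v : G.V} (e : {k // G.vert k = v} ≃ Fin q)

/-- The half-edges at the two ends of the disorder edge at `v`, numbered in such a way that
each strand joins two half-edges with the same number. -/
def leg (p : Bool × Fin q) : G.H :=
  if p.1 then G.strand (e.symm p.2) else e.symm p.2

theorem vert_leg_false (i : Fin q) : G.vert (leg e (false, i)) = v :=
  (e.symm i).2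

theorem vert_leg_true (i : Fin q) : G.vert (leg e (true, i)) = G.partner v := by
  change G.vert (G.strand (e.symm i)) = _
  rw [G.vert_strand, (e.symm i).2]

theorem vert_leg_mem (p : Bool × Fin q) : G.vert (leg e p) ∈ G.pair v := by
  obtain ⟨_ | _, i⟩ := p
  · exact .inl (vert_leg_false e i)
  · exact .inr (vert_leg_true e i)

theorem strand_leg (b : Bool) (i : Fin q) : G.strand (leg e (b, i)) = leg e (!b, i) := by
  cases b
  · rfl
  · exact G.strand_strand _

theorem leg_injective : Function.Injective (leg e) := by
  have hb : ∀ i j, leg e (false, i) ≠ leg e (true, j) := by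
    intro i j h
    have := congrArg G.vert h
    rw [vert_leg_false, vert_leg_true] at this
    exact G.partner_ne v this.symm
  have hf : ∀ i j, leg e (false, i) = leg e (false, j) → i = j := fun i j h =>
    e.symm.injective (Subtype.ext h)
  rintro ⟨_ | _, i⟩ ⟨_ | _, j⟩ h
  · rw [hf i j h]
  · exact (hb _ _ h).elim
  · exact (hb _ _ h.symm).elim
  · have := congrArg G.strand h
    rw [strand_leg, strand_leg] at this
    rw [hf i j this]

theorem exists_leg_eq {k : G.H} (hk : G.vert k ∈ G.pair v) : ∃ p, leg e p = k := by
  rcases hk with hk | hk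
  · exact ⟨(false, e ⟨k, hk⟩), congrArg Subtype.val (e.symm_apply_apply ⟨k, hk⟩)⟩
  · refine ⟨(true, e ⟨G.strand k, by rw [G.vert_strand, hk, G.partner_partner]⟩), ?_⟩
    exact (congrArg G.strand (congrArg Subtype.val (e.symm_apply_apply _))).trans
      (G.strand_strand k)

end Leg

theorem nonempty_leg_equiv (v : G.V) : Nonempty ({k // G.vert k = v} ≃ Fin q) := by
  have := G.finite_H
  rw [← Finite.card_eq, G.card_vert, Nat.card_fin]

namespace IsDipole

variable {h : G.H}

theorem line_eq_strand (hd : IsDipole h) {k : G.H} (hk : G.vert k ∈ G.pair (G.vert h))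
    (h₁ : k ≠ h) (h₂ : k ≠ G.strand h) : G.line k = G.strand k := by
  rcases hk with hk | hk
  · exact hd k hk h₁
  · have := hd (G.strand k) (by rw [G.vert_strand, hk, G.partner_partner])
      (fun e => h₂ (by rw [← e, G.strand_strand]))
    rw [G.strand_strand] at this
    rw [← this, G.line_line, this]

theorem vert_line_notMem (hd : IsDipole h) {k : G.H} (hk : G.vert k ∉ G.pair (G.vert h))
    (h₁ : G.line k ≠ h) (h₂ : G.line k ≠ G.strand h) :
    G.vert (G.line k) ∉ G.pair (G.vert h) := by
  intro hm
  have := hd.line_eq_strand hm h₁ h₂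
  rw [G.line_line] at this
  refine hk ?_
  rw [this, G.vert_strand]
  exact partner_mem_pair hm

theorem vert_line_self_notMem (hd : IsDipole h) (hne : G.line h ≠ G.strand h) :
    G.vert (G.line h) ∉ G.pair (G.vert h) := by
  intro hm
  have := hd.line_eq_strand hm (G.line_ne h) hne
  rw [G.line_line] at this
  refine hne ?_
  conv_rhs => rw [this, G.strand_strand]

theorem vert_line_strand_notMem (hd : IsDipole h) (hne : G.line h ≠ G.strand h) :
    G.vert (G.line (G.strand h)) ∉ G.pair (G.vert h) := by
  intro hm
  have := hd.line_eq_strand hm (fun e => hne (by rw [← G.line_line (G.strand h), e]))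
    (G.line_ne _)
  rw [G.line_line] at this
  have := congrArg G.strand this
  rw [G.strand_strand, G.strand_strand] at this
  exact hne (by rw [← G.line_line (G.strand h), ← this])

/-- If the strand of `h` is parallel to a line as well, a connected graph has no further
vertex. -/
theorem nonempty_iso_gMin (hq : 0 < q) (hd : IsDipole h) (hG : G.Linked)
    (he : G.line h = G.strand h) : Nonempty (Iso (gMin q) G) := by
  have hline : ∀ k, G.vert k ∈ G.pair (G.vert h) → G.line k = G.strand k := by
    intro k hk
    by_cases h₁ : k = h
    · rw [h₁, he]
    by_cases h₂ : k = G.strand h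
    · rw [h₂, ← he, G.line_line, he, G.strand_strand]
    exact hd.line_eq_strand hk h₁ h₂
  have hV : ∀ z, z ∈ G.pair (G.vert h) := by
    intro z
    obtain ⟨k, rfl⟩ := exists_vert_eq hq z
    have hle : G.cut ∅ ≤ Setoid.ker fun k => G.vert k ∈ G.pair (G.vert h) := by
      refine cut_le (fun k => propext ?_) (fun h hh => hh.elim)
        (fun k k' _ e => congrArg (· ∈ G.pair (G.vert h)) e)
      have aux : ∀ k, G.vert k ∈ G.pair (G.vert h) →
          G.vert (G.line k) ∈ G.pair (G.vert h) := fun k hk => by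
        rw [hline k hk, G.vert_strand]; exact partner_mem_pair hk
      exact ⟨aux k, fun hk => G.line_line k ▸ aux _ hk⟩
    have heq : (G.vert h ∈ G.pair (G.vert h)) = (G.vert k ∈ G.pair (G.vert h)) :=
      hle (hG.2 h k)
    exact heq.mp (.inl rfl)
  obtain ⟨e⟩ := nonempty_leg_equiv (G.vert h)
  refine ⟨{
    onV := Equiv.ofBijective (fun b : Bool => if b then G.partner (G.vert h) else G.vert h) ?_
    onH := Equiv.ofBijective (leg e)
      ⟨leg_injective e, fun k => exists_leg_eq e (hV (G.vert k))⟩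
    map_vert := ?_
    map_line := ?_
    map_partner := ?_
    map_strand := ?_ }⟩
  · refine ⟨?_, fun z => ?_⟩
    · rintro (_ | _) (_ | _) hb
      · rfl
      · exact (G.partner_ne _ hb.symm).elim
      · exact (G.partner_ne _ hb).elim
      · rfl
    · rcases hV z with rfl | rfl
      exacts [⟨false, rfl⟩, ⟨true, rfl⟩]
  · rintro ⟨_ | _, i⟩
    · exact vert_leg_false e i
    · exact vert_leg_true e i
  · rintro ⟨b, i⟩
    exact (hline _ (vert_leg_mem e _)).trans (strand_leg e b i)
  · rintro (_ | _)
    · rfl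
    · exact G.partner_partner _
  · rintro ⟨b, i⟩
    exact strand_leg e b i

open Classical in
/-- The graph without the two ends of the disorder edge through `h`, in which the two lines that
become open are replaced by a single one. -/
noncomputable def remove (hd : IsDipole h) (hne : G.line h ≠ G.strand h) :
    StrandedGraph.{u} q where
  V := {z : G.V // z ∉ G.pair (G.vert h)}
  H := {k : G.H // G.vert k ∉ G.pair (G.vert h)}
  finite_V := by have := G.finite_V; infer_instance
  finite_H := by have := G.finite_H; infer_instance
  vert k := ⟨G.vert k, k.2⟩
  card_vert z := by
    refine (Nat.card_congr ?_).trans (G.card_vert z)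
    exact
      { toFun := fun k => ⟨k.1, congrArg Subtype.val k.2⟩
        invFun := fun k => ⟨⟨k.1, k.2.symm ▸ z.2⟩, Subtype.ext k.2⟩
        left_inv := fun k => rfl
        right_inv := fun k => rfl }
  line k :=
    if h₁ : G.line k = h then ⟨G.line (G.strand h), hd.vert_line_strand_notMem hne⟩
    else if h₂ : G.line k = G.strand h then ⟨G.line h, hd.vert_line_self_notMem hne⟩
    else ⟨G.line k, hd.vert_line_notMem k.2 h₁ h₂⟩
  line_line := by
    rintro ⟨k, hk⟩
    have hs : G.strand h ≠ h := fun e => G.partner_ne (G.vert h) (by rw [← G.vert_strand, e])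
    by_cases h₁ : G.line k = h
    · have e : G.line h = k := by rw [← h₁, G.line_line]
      simp [h₁, G.line_line, hs, e]
    by_cases h₂ : G.line k = G.strand h
    · have e : G.line (G.strand h) = k := by rw [← h₂, G.line_line]
      simp [hs, h₂, G.line_line, e]
    have h₃ : k ≠ h := by rintro rfl; exact hk (.inl rfl)
    have h₄ : k ≠ G.strand h := by rintro rfl; exact hk (.inr (G.vert_strand h))
    simp [h₁, h₂, h₃, h₄, G.line_line]
  line_ne := by
    rintro ⟨k, hk⟩ e
    have hs : G.strand h ≠ h := fun e => G.partner_ne (G.vert h) (by rw [← G.vert_strand, e])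
    by_cases h₁ : G.line k = h
    · rw [dif_pos h₁] at e
      have e' : G.line (G.strand h) = k := congrArg Subtype.val e
      have : G.strand h = G.line k := by rw [← e', G.line_line]
      exact hs (this.trans h₁)
    by_cases h₂ : G.line k = G.strand h
    · rw [dif_neg h₁, dif_pos h₂] at e
      have e' : G.line h = k := congrArg Subtype.val e
      exact h₁ (by rw [← e', G.line_line])
    · rw [dif_neg h₁, dif_neg h₂] at e
      exact G.line_ne k (congrArg Subtype.val e)
  partner z := ⟨G.partner z, partner_notMem_pair z.2⟩
  partner_partner z := Subtype.ext (G.partner_partner z)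
  partner_ne z e := G.partner_ne z (congrArg Subtype.val e)
  strand k := ⟨G.strand k, by rw [G.vert_strand]; exact partner_notMem_pair k.2⟩
  strand_strand k := Subtype.ext (G.strand_strand k)
  vert_strand k := Subtype.ext (G.vert_strand k)

/-- A dipole which is not the whole graph arises from an insertion. -/
theorem exists_iso_insertDipole (hd : IsDipole h) (hne : G.line h ≠ G.strand h) :
    ∃ (G' : StrandedGraph.{u} q) (x : G'.H) (i₀ : Fin q),
      Nonempty (Iso (G'.insertDipole x i₀) G) := by
  obtain ⟨e⟩ := nonempty_leg_equiv (G.vert h)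
  let G' := hd.remove hne
  let x : G'.H := ⟨G.line h, hd.vert_line_self_notMem hne⟩
  have hx : G'.line x = ⟨G.line (G.strand h), hd.vert_line_strand_notMem hne⟩ :=
    dif_pos (G.line_line h)
  let i₀ := e ⟨h, rfl⟩
  have hf : leg e (false, i₀) = h := congrArg Subtype.val (e.symm_apply_apply ⟨h, rfl⟩)
  have ht : leg e (true, i₀) = G.strand h :=
    (strand_leg e false i₀).symm.trans (congrArg G.strand hf)
  refine ⟨G', x, i₀, ⟨{
    onV := Equiv.ofBijective (Sum.elim Subtype.val
      fun b : Bool => if b then G.partner (G.vert h) else G.vert h) ⟨?_, fun z => ?_⟩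
    onH := Equiv.ofBijective (Sum.elim Subtype.val (leg e)) ⟨?_, fun k => ?_⟩
    map_vert := ?_
    map_line := ?_
    map_partner := ?_
    map_strand := ?_ }⟩⟩
  · refine Subtype.val_injective.sumElim ?_ ?_
    · rintro (_ | _) (_ | _) hb
      · rfl
      · exact (G.partner_ne _ hb.symm).elim
      · exact (G.partner_ne _ hb).elim
      · rfl
    · rintro ⟨z, hz⟩ (_ | _) rfl
      · exact hz (.inl rfl)
      · exact hz (.inr rfl)
  · by_cases hz : z ∈ G.pair (G.vert h)
    · rcases hz with rfl | rfl
      exacts [⟨.inr false, rfl⟩, ⟨.inr true, rfl⟩]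
    · exact ⟨.inl ⟨z, hz⟩, rfl⟩
  · refine Subtype.val_injective.sumElim (leg_injective e) ?_
    rintro ⟨k, hk⟩ p rfl
    exact hk (vert_leg_mem e p)
  · by_cases hk : G.vert k ∈ G.pair (G.vert h)
    · obtain ⟨p, hp⟩ := exists_leg_eq e hk
      exact ⟨.inr p, hp⟩
    · exact ⟨.inl ⟨k, hk⟩, rfl⟩
  · rintro (k | ⟨_ | _, i⟩)
    · rfl
    · exact vert_leg_false e i
    · exact vert_leg_true e i
  · rintro (k | ⟨b, i⟩)
    · by_cases h₁ : k = x
      · subst h₁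
        rw [line_inl_self]
        exact (G.line_line h).trans hf.symm
      by_cases h₂ : k = G'.line x
      · subst h₂
        rw [line_inl_line]
        change G.line (G'.line x).1 = _
        rw [hx]
        exact (G.line_line _).trans ht.symm
      · rw [line_inl_of_ne _ _ h₁ h₂]
        have h₃ : G.line k.1 ≠ h := fun hk =>
          h₁ (Subtype.ext (by rw [← G.line_line k.1, hk]))
        have h₄ : G.line k.1 ≠ G.strand h := fun hk =>
          h₂ (hx ▸ Subtype.ext (by rw [← G.line_line k.1, hk]))
        exact congrArg Subtype.val (show G'.line k = _ from (dif_neg h₃).trans (dif_neg h₄)).symm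
    · by_cases hi : i = i₀
      · cases b
        · rw [hi, line_inr_false]
          exact congrArg G.line hf
        · rw [hi, line_inr_true, hx]
          exact congrArg G.line ht
      · rw [line_inr_of_ne _ _ b hi]
        refine (hd.line_eq_strand (vert_leg_mem e (b, i)) ?_ ?_).trans (strand_leg e b i)
        · intro hk
          exact hi (congrArg Prod.snd (leg_injective e (hk.trans hf.symm)))
        · intro hk
          exact hi (congrArg Prod.snd (leg_injective e (hk.trans ht.symm)))
  · rintro (z | _ | _)
    · rfl
    · rfl
    · exact G.partner_partner _
  · rintro (k | ⟨b, i⟩)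
    · rfl
    · exact strand_leg e b i

end IsDipole

theorem Maximal.isMelonic (hq : 2 ≤ q) (hG : G.Maximal) : G.IsMelonic := by
  generalize hn : G.numVertices = n
  induction n using Nat.strong_induction_on generalizing G with
  | _ n ih =>
    obtain ⟨h, hd⟩ := hG.exists_isDipole (by omega)
    by_cases he : G.line h = G.strand h
    · exact .base G ⟨(hd.nonempty_iso_gMin (by omega) hG.1 he).some.symm⟩
    · obtain ⟨G', x, i₀, ⟨e⟩⟩ := hd.exists_iso_insertDipole he
      have hV := e.numVertices_eq
      rw [numVertices_insertDipole] at hV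
      exact .move G' G x i₀ (ih _ (by omega)
        ((maximal_insertDipole_iff x i₀ hq).1 (e.symm.maximal hG)) rfl) ⟨e.symm⟩

end StrandedGraph

theorem mainTheorem1 (q : ℕ) (hq : 2 ≤ q) :
    (∀ G : StrandedGraph.{u} q, G.IsSYK → G.degree ≤ 1) ∧
      ∀ G : StrandedGraph.{u} q, (G.IsSYK ∧ G.degree = 1) ↔ G.IsMelonic := by
  have hq' : 0 < q := by omega
  refine ⟨fun G hG => ?_, fun G => ⟨fun hG => ?_, fun hG => ?_⟩⟩
  · exact (StrandedGraph.degree_le_one_iff hq').2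
      (((StrandedGraph.linked_iff hq').2 hG.1).two_mul_numFaces_le hq')
  · exact StrandedGraph.Maximal.isMelonic hq ⟨(StrandedGraph.linked_iff hq').2 hG.1.1,
      (StrandedGraph.degree_eq_one_iff hq').1 hG.2⟩
  · have hm := hG.maximal hq
    exact ⟨⟨(StrandedGraph.linked_iff hq').1 hm.1, hm.vert_line_ne hq'⟩,
      (StrandedGraph.degree_eq_one_iff hq').2 hm.2⟩
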